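/- **Setting.** Let $\mathcal M=(\mathcal S,\mathcal A_1,\mathcal A_2,\mathcal Z_1,\mathcal Z_2,p,r,b,\gamma,\ell)$ be a zero-sum partially observable stochastic game with finite state set, nonempty finite action sets and finite observation sets, kernel $p(s',z_1,z_2\mid s,a_1,a_2)$, payoff $r(s,a_1,a_2)$ to player 1 (the maximiser), initial distribution $b$ on $\mathcal S$, discount $\gamma\in[0,1)$ and finite horizon $\ell$. The private histories of player $i$ at stage $t$ are $\mathcal H_{i,t}=(\mathcal A_i\times\mathcal Z_i)^t$, and $\mathcal D_{i,t}$ is the set of decision rules $\mathcal H_{i,t}\to\Delta(\mathcal A_i)$. Put $\Omega_{1,t}=\mathcal S\times\mathcal H_{1,t}$ and $\Omega_{2,t}=\mathcal S\times\mathcal H_{1,t}\times\mathcal A_1$. An occupancy at sub-stage $(i,t)$ is a probability distribution $x_i$ on $\Omega_{i,t}\times\mathcal H_{2,t}$ (with $t\le\ell$ if $i=1$ and $t<\ell$ if $i=2$). The optimal sequential value is defined by $v^*_{\mathrm{seq}}=0$ at sub-stage $(1,\ell)$ and, for $t<\ell$, $$v^*_{\mathrm{seq}}(x_1)=\max_{d_1\in\mathcal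 D_{1,t}}v^*_{\mathrm{seq}}(\tau(x_1,d_1)),\qquad v^*_{\mathrm{seq}}(x_2)=\min_{d_2\in\mathcal D_{2,t}}\bigl[\rho(x_2,d_2)+\gamma\,v^*_{\mathrm{seq}}(\tau(x_2,d_2))\bigr],$$ where $\tau(x_1,d_1)(s,h_1,a_1,h_2)=x_1(s,h_1,h_2)\,d_1(a_1\mid h_1)$, where $\tau(x_2,d_2)$ is the law of $(s',h_1a_1z_1,h_2a_2z_2)$ when $(s,h_1,a_1,h_2)\sim x_2$, $a_2\sim d_2(\cdot\mid h_2)$ and $(s',z_1,z_2)\sim p(\cdot\mid s,a_1,a_2)$, and where $\rho(x_2,d_2)$ is the expectation of $r(s,a_1,a_2)$ under the same law. **Envelopes.** A continuation $\pi$ of player 1 from $(i,t)$ is a sequence of decision rules of player 1 for the stages $t,\dots,\ell-1$ if $i=1$, and for the stages $t+1,\dots,\ell-1$ if $i=2$. A continuation tree $\kappa$ of player 2 is a deterministic policy tree for the stages $t,\dots,\ell-1$: a root action and, for each observation, a subtree. Let $\alpha^{\pi,\kappa}\in\mathbb R^{\Omega_{i,t}}$ be the vector whose entry at $\omega$ is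 the expected discounted payoff of the stages $t,\dots,\ell-1$ when the game starts from $\omega$ at stage $t$ and the players follow $\pi$ and $\kappa$, and let $\Gamma_2^\pi=\{\alpha^{\pi,\kappa}:\kappa\}$. For $\Gamma_2\subset\mathbb R^{\Omega_{i,t}}$ finite and nonempty put $$\mathtt{Val}_{\Gamma_2}(x_i)=\sum_{h_2\in\mathcal H_{2,t}}\min_{\alpha\in\Gamma_2}\langle b_{h_2},\alpha\rangle,\qquad b_{h_2}(\omega)=x_i(\omega,h_2).$$ Call $\pi$ dominated if for every occupancy $x_i$ there is a continuation $\pi'$ with $\mathtt{Val}_{\Gamma_2^\pi}(x_i)<\mathtt{Val}_{\Gamma_2^{\pi'}}(x_i)$, and Pareto-dominated if there is one $\pi'$ with $\mathtt{Val}_{\Gamma_2^\pi}\le\mathtt{Val}_{\Gamma_2^{\pi'}}$ at all occupancies and strict inequality at some occupancy. **Theorem (Max-of-Concave geometry).** Fix a sub-stage $(i,t)$, and let $\Gamma_1$ be any family of sets $\Gamma_2^\pi$ which contains $\Gamma_2^\pi$ for every continuation $\pi$ that is neither dominated nor Pareto-dominated. (So $\Gamma_1$ may consist of the $\Gamma_2^\pi$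 of all non-dominated continuations, in either sense of the word, or of all continuations.) Then every $\Gamma_2\in\Gamma_1$ is finite and nonempty, and for every occupancy $x_i$ at this sub-stage $$v^*_{\mathrm{seq}}(x_i)=\max_{\Gamma_2\in\Gamma_1}\mathtt{Val}_{\Gamma_2}(x_i),$$ where the maximum is attained. -/

import Mathlib

universe u v

noncomputable section

/-- A zero-sum partially observable stochastic game with simultaneous moves: player 1 maximises,
player 2 minimises. -/
structure ZsPOSG (S A₁ A₂ Z₁ Z₂ : Type*) [Fintype S] [Fintype Z₁] [Fintype Z₂] where
  /-- `p s a₁ a₂ (s', z₁, z₂)` is the probability of `(s', z₁, z₂)` given `(s, a₁, a₂)`. -/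
  p : S → A₁ → A₂ → S × Z₁ × Z₂ → ℝ
  p_mem : ∀ s a₁ a₂, p s a₁ a₂ ∈ stdSimplex ℝ (S × Z₁ × Z₂)
  /-- the stage payoff to player 1 -/
  r : S → A₁ → A₂ → ℝ
  /-- the initial state distribution -/
  b : S → ℝ
  b_mem : b ∈ stdSimplex ℝ S
  /-- the discount factor -/
  γ : ℝ
  γ_nonneg : 0 ≤ γ
  γ_lt_one : γ < 1
  /-- the horizon -/
  ℓ : ℕ

/-- Private histories at stage `t`: the `t` action-observation pairs seen so far. -/
abbrev Hist (A Z : Type*) (t : ℕ) : Type _ := Fin t → A × Z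

/-- The history `h` followed by the pair `(a, z)`. -/
def Hist.snoc {A Z : Type*} {t : ℕ} (h : Hist A Z t) (a : A) (z : Z) : Hist A Z (t + 1) :=
  Fin.snoc (α := fun _ => A × Z) h (a, z)

/-- The history `h` without its last pair. -/
def Hist.init {A Z : Type*} {t : ℕ} (h : Hist A Z (t + 1)) : Hist A Z t :=
  fun k => h k.castSucc

/-- The last action of a history. -/
def Hist.lastAct {A Z : Type*} {t : ℕ} (h : Hist A Z (t + 1)) : A := (h (Fin.last t)).1

/-- The last observation of a history. -/
def Hist.lastObs {A Z : Type*} {t : ℕ} (h : Hist A Z (t + 1)) : Z := (h (Fin.last t)).2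

theorem Hist.init_snoc {A Z : Type*} {t : ℕ} (h : Hist A Z t) (a : A) (z : Z) :
    (h.snoc a z).init = h := by
  funext k
  simp [Hist.init, Hist.snoc]

theorem Hist.lastAct_snoc {A Z : Type*} {t : ℕ} (h : Hist A Z t) (a : A) (z : Z) :
    (h.snoc a z).lastAct = a := by
  simp [Hist.lastAct, Hist.snoc]

theorem Hist.lastObs_snoc {A Z : Type*} {t : ℕ} (h : Hist A Z t) (a : A) (z : Z) :
    (h.snoc a z).lastObs = z := by
  simp [Hist.lastObs, Hist.snoc]

theorem Hist.sum_snoc {A Z : Type*} [Fintype A] [Fintype Z] {t : ℕ} (f : Hist A Z (t + 1) → ℝ) :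
    ∑ h, f h = ∑ h : Hist A Z t, ∑ a, ∑ z, f (h.snoc a z) := by
  rw [← (Fin.snocEquiv (fun _ : Fin (t + 1) => A × Z)).sum_comp, Fintype.sum_prod_type_right]
  simp only [Fintype.sum_prod_type]
  rfl

/-- Decision rules at stage `t`: maps from private histories to distributions over actions. -/
abbrev DecisionRule (A Z : Type*) [Fintype A] (t : ℕ) : Type _ := Hist A Z t → stdSimplex ℝ A

/-- What is uncertain to player 2 at sub-stage `(1, t)`: state and history of player 1. -/
abbrev Omega₁ (S A₁ Z₁ : Type*) (t : ℕ) : Type _ := S × Hist A₁ Z₁ t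

/-- What is uncertain to player 2 at sub-stage `(2, t)`: state, history and action of player 1. -/
abbrev Omega₂ (S A₁ Z₁ : Type*) (t : ℕ) : Type _ := S × Hist A₁ Z₁ t × A₁

/-! ### The two-layer envelope, for a general index set `Ω` and general histories `H` of player 2 -/

section Envelope

variable {Ω H P : Type*} [Fintype Ω] [Fintype H]

/-- The unnormalised slice `b_{h₂}` of `x` at the history `h` of player 2. -/
def slice (x : Ω × H → ℝ) (h : H) : Ω → ℝ := fun ω => x (ω, h)

/-- `Val_{Γ₂}(x) = ∑_{h₂} min_{α ∈ Γ₂} ⟨b_{h₂}, α⟩`; the infimum is a minimum for the finite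
nonempty `Γ₂` to which it is applied. -/
def Val (Γ₂ : Set (Ω → ℝ)) (x : Ω × H → ℝ) : ℝ :=
  ∑ h, sInf ((fun α => slice x h ⬝ᵥ α) '' Γ₂)

variable (H)

/-- The member `π` of the family `G` is dominated: at every occupancy some other member is
strictly better. -/
def IsDominated (G : P → Set (Ω → ℝ)) (π : P) : Prop :=
  ∀ x ∈ stdSimplex ℝ (Ω × H), ∃ π', Val (G π) x < Val (G π') x

/-- The member `π` of the family `G` is dominated by a single other member, which is at least as
good at every occupancy and strictly better at one of them. -/
def IsParetoDominated (G : P → Set (Ω → ℝ)) (π : P) : Prop :=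
  ∃ π', (∀ x ∈ stdSimplex ℝ (Ω × H), Val (G π) x ≤ Val (G π') x) ∧
    ∃ x ∈ stdSimplex ℝ (Ω × H), Val (G π) x < Val (G π') x

/-- `Γ₁` consists of sets `G π` and contains all non-dominated ones. Only the `G π` which are
non-dominated in both senses are required to be present, so that `Γ₁` may be the family of all
`G π`, or that of the non-dominated ones in either sense. -/
def RepresentsNonDominated (G : P → Set (Ω → ℝ)) (Γ₁ : Set (Set (Ω → ℝ))) : Prop :=
  Γ₁ ⊆ Set.range G ∧
    ∀ π, ¬ IsDominated H G π → ¬ IsParetoDominated H G π → G π ∈ Γ₁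

end Envelope

/-- Continuation policies with `n` decision rules, for the stages `t, …, t + n - 1`. -/
def Continuation (A : Type u) (Z : Type v) [Fintype A] : ℕ → ℕ → Type (max u v)
  | 0, _ => PUnit
  | n + 1, t => DecisionRule A Z t × Continuation A Z n (t + 1)

/-- Deterministic policy trees of depth `n`: a root action, and a tree of depth `n - 1` for each
observation. -/
def PolicyTree (A : Type u) (Z : Type v) : ℕ → Type (max u v)
  | 0 => PUnit
  | n + 1 => A × (Z → PolicyTree A Z n)

namespace ZsPOSG

variable {S A₁ A₂ Z₁ Z₂ : Type*} [Fintype S] [Fintype A₁] [Fintype A₂] [Fintype Z₁] [Fintype Z₂]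

/-! ### Sequential dynamics and rewards -/

/-- The occupancy at sub-stage `(1, 0)`. -/
def initOcc (M : ZsPOSG S A₁ A₂ Z₁ Z₂) : Omega₁ S A₁ Z₁ 0 × Hist A₂ Z₂ 0 → ℝ :=
  fun y => M.b y.1.1

/-- The transition `τ_seq` from sub-stage `(1, t)` to `(2, t)`. -/
def trans₁ (_M : ZsPOSG S A₁ A₂ Z₁ Z₂) {t : ℕ} (x : Omega₁ S A₁ Z₁ t × Hist A₂ Z₂ t → ℝ)
    (d : DecisionRule A₁ Z₁ t) : Omega₂ S A₁ Z₁ t × Hist A₂ Z₂ t → ℝ :=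
  fun ((s, h₁, a₁), h₂) => x ((s, h₁), h₂) * (d h₁).1 a₁

/-- The transition `τ_seq` from sub-stage `(2, t)` to `(1, t + 1)`. -/
def trans₂ (M : ZsPOSG S A₁ A₂ Z₁ Z₂) {t : ℕ} (x : Omega₂ S A₁ Z₁ t × Hist A₂ Z₂ t → ℝ)
    (d : DecisionRule A₂ Z₂ t) : Omega₁ S A₁ Z₁ (t + 1) × Hist A₂ Z₂ (t + 1) → ℝ :=
  fun ((s', h₁), h₂) => ∑ s, x ((s, h₁.init, h₁.lastAct), h₂.init) * (d h₂.init).1 h₂.lastAct *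
    M.p s h₁.lastAct h₂.lastAct (s', h₁.lastObs, h₂.lastObs)

/-- The reward `ρ_seq` at sub-stage `(2, t)`, the expected stage payoff. The reward at sub-stage
`(1, t)` is zero. -/
def reward₂ (M : ZsPOSG S A₁ A₂ Z₁ Z₂) {t : ℕ} (x : Omega₂ S A₁ Z₁ t × Hist A₂ Z₂ t → ℝ)
    (d : DecisionRule A₂ Z₂ t) : ℝ :=
  ∑ y : Omega₂ S A₁ Z₁ t × Hist A₂ Z₂ t, ∑ a₂,
    x y * (d y.2).1 a₂ * M.r y.1.1 y.1.2.2 a₂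

/-- The initial occupancy is a distribution. -/
theorem initOcc_mem (M : ZsPOSG S A₁ A₂ Z₁ Z₂) :
    M.initOcc ∈ stdSimplex ℝ (Omega₁ S A₁ Z₁ 0 × Hist A₂ Z₂ 0) := by
  refine ⟨fun y => M.b_mem.1 _, ?_⟩
  have h := M.b_mem.2
  simpa [initOcc, Fintype.sum_prod_type] using h

/-- Transitions from sub-stage `(1, t)` lead from distributions to distributions. -/
theorem trans₁_mem (M : ZsPOSG S A₁ A₂ Z₁ Z₂) {t : ℕ}
    {x : Omega₁ S A₁ Z₁ t × Hist A₂ Z₂ t → ℝ}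
    (hx : x ∈ stdSimplex ℝ (Omega₁ S A₁ Z₁ t × Hist A₂ Z₂ t)) (d : DecisionRule A₁ Z₁ t) :
    M.trans₁ x d ∈ stdSimplex ℝ (Omega₂ S A₁ Z₁ t × Hist A₂ Z₂ t) := by
  refine ⟨fun y => mul_nonneg (hx.1 _) ((d _).2.1 _), ?_⟩
  rw [← hx.2]
  simp only [Fintype.sum_prod_type, trans₁]
  refine Finset.sum_congr rfl fun s _ => Finset.sum_congr rfl fun h₁ _ => ?_
  rw [Finset.sum_comm]
  refine Finset.sum_congr rfl fun h₂ _ => ?_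
  rw [← Finset.mul_sum, (d h₁).2.2, mul_one]

/-- Transitions from sub-stage `(2, t)` lead from distributions to distributions. -/
theorem trans₂_mem (M : ZsPOSG S A₁ A₂ Z₁ Z₂) {t : ℕ}
    {x : Omega₂ S A₁ Z₁ t × Hist A₂ Z₂ t → ℝ}
    (hx : x ∈ stdSimplex ℝ (Omega₂ S A₁ Z₁ t × Hist A₂ Z₂ t)) (d : DecisionRule A₂ Z₂ t) :
    M.trans₂ x d ∈ stdSimplex ℝ (Omega₁ S A₁ Z₁ (t + 1) × Hist A₂ Z₂ (t + 1)) := by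
  refine ⟨fun y => Finset.sum_nonneg fun s _ =>
    mul_nonneg (mul_nonneg (hx.1 _) ((d _).2.1 _)) ((M.p_mem _ _ _).1 _), ?_⟩
  let e : S × (Hist A₁ Z₁ t × A₁ × Z₁) × (Hist A₂ Z₂ t × A₂ × Z₂) × S ≃
      ((S × Hist A₁ Z₁ t × A₁) × Hist A₂ Z₂ t) × A₂ × S × Z₁ × Z₂ :=
    { toFun := fun q => (((q.2.2.2, q.2.1.1, q.2.1.2.1), q.2.2.1.1), q.2.2.1.2.1, q.1,
        q.2.1.2.2, q.2.2.1.2.2)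
      invFun := fun q => (q.2.2.1, (q.1.1.2.1, q.1.1.2.2, q.2.2.2.1),
        (q.1.2, q.2.1, q.2.2.2.2), q.1.1.1)
      left_inv := fun _ => rfl
      right_inv := fun _ => rfl }
  have key := Fintype.sum_equiv e
    (fun q => x ((q.2.2.2, q.2.1.1, q.2.1.2.1), q.2.2.1.1) * (d q.2.2.1.1).1 q.2.2.1.2.1 *
      M.p q.2.2.2 q.2.1.2.1 q.2.2.1.2.1 (q.1, q.2.1.2.2, q.2.2.1.2.2))
    (fun q => x q.1 * (d q.1.2).1 q.2.1 * M.p q.1.1.1 q.1.1.2.2 q.2.1 q.2.2) (fun _ => rfl)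
  have hr : ∑ q : ((S × Hist A₁ Z₁ t × A₁) × Hist A₂ Z₂ t) × A₂ × S × Z₁ × Z₂,
      x q.1 * (d q.1.2).1 q.2.1 * M.p q.1.1.1 q.1.1.2.2 q.2.1 q.2.2 = 1 := by
    rw [Fintype.sum_prod_type, ← hx.2]
    refine Finset.sum_congr rfl fun y _ => ?_
    rw [Fintype.sum_prod_type]
    simp only [← Finset.mul_sum, (M.p_mem _ _ _).2, mul_one, (d _).2.2]
  rw [← hr, ← key]
  simp only [Fintype.sum_prod_type, trans₂, Hist.sum_snoc, Hist.init_snoc, Hist.lastAct_snoc,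
    Hist.lastObs_snoc]

/-! ### The optimal sequential value, by the Bellman equations

The suprema and infima below are over compact sets of decision rules and are attained. -/

/-- The Bellman operator of player 1 at sub-stage `(1, t)`. -/
def bellman₁ (M : ZsPOSG S A₁ A₂ Z₁ Z₂) {t : ℕ}
    (v : (Omega₂ S A₁ Z₁ t × Hist A₂ Z₂ t → ℝ) → ℝ)
    (x : Omega₁ S A₁ Z₁ t × Hist A₂ Z₂ t → ℝ) : ℝ :=
  ⨆ d : DecisionRule A₁ Z₁ t, v (M.trans₁ x d)

/-- The Bellman operator of player 2 at sub-stage `(2, t)`. -/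
def bellman₂ (M : ZsPOSG S A₁ A₂ Z₁ Z₂) {t : ℕ}
    (v : (Omega₁ S A₁ Z₁ (t + 1) × Hist A₂ Z₂ (t + 1) → ℝ) → ℝ)
    (x : Omega₂ S A₁ Z₁ t × Hist A₂ Z₂ t → ℝ) : ℝ :=
  ⨅ d : DecisionRule A₂ Z₂ t, (M.reward₂ x d + M.γ * v (M.trans₂ x d))

/-- The optimal value at sub-stage `(1, t)` when `n` stages are left. -/
def valueToGo (M : ZsPOSG S A₁ A₂ Z₁ Z₂) :
    (n t : ℕ) → (Omega₁ S A₁ Z₁ t × Hist A₂ Z₂ t → ℝ) → ℝ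
  | 0, _ => fun _ => 0
  | n + 1, t => M.bellman₁ (M.bellman₂ (valueToGo M n (t + 1)))

/-- `v*_seq` at sub-stage `(1, t)`, for `t ≤ ℓ`. -/
def vSeq₁ (M : ZsPOSG S A₁ A₂ Z₁ Z₂) (t : ℕ) :
    (Omega₁ S A₁ Z₁ t × Hist A₂ Z₂ t → ℝ) → ℝ :=
  M.valueToGo (M.ℓ - t) t

/-- `v*_seq` at sub-stage `(2, t)`, for `t < ℓ`. -/
def vSeq₂ (M : ZsPOSG S A₁ A₂ Z₁ Z₂) (t : ℕ) :
    (Omega₂ S A₁ Z₁ t × Hist A₂ Z₂ t → ℝ) → ℝ :=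
  M.bellman₂ (M.vSeq₁ (t + 1))

/-- The Bellman equation at sub-stage `(1, t)`; the one at `(2, t)` is the definition of
`vSeq₂`. -/
theorem vSeq₁_eq (M : ZsPOSG S A₁ A₂ Z₁ Z₂) {t : ℕ} (ht : t < M.ℓ) :
    M.vSeq₁ t = M.bellman₁ (M.vSeq₂ t) := by
  have h : M.ℓ - t = (M.ℓ - (t + 1)) + 1 := by omega
  rw [vSeq₁, h, valueToGo, vSeq₂, vSeq₁]

/-! ### Value vectors -/

/-- One step of evaluation: the value vector at sub-stage `(2, t)` when player 2 plays `a₂` and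
`β z₂` is the value vector at sub-stage `(1, t + 1)` after the observation `z₂`. -/
def backProject (M : ZsPOSG S A₁ A₂ Z₁ Z₂) {t : ℕ} (a₂ : A₂)
    (β : Z₂ → Omega₁ S A₁ Z₁ (t + 1) → ℝ) : Omega₂ S A₁ Z₁ t → ℝ :=
  fun (s, h₁, a₁) => M.r s a₁ a₂ +
    M.γ * ∑ o : S × Z₁ × Z₂, M.p s a₁ a₂ o * β o.2.2 (o.1, h₁.snoc a₁ o.2.1)

/-- `alpha₁ n t π κ (s, h₁)` is the expected discounted payoff of the stages `t, …, t + n - 1`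
from the state `s` and the history `h₁` of player 1, when player 1 follows `π` and player 2
follows the tree `κ`. -/
def alpha₁ (M : ZsPOSG S A₁ A₂ Z₁ Z₂) : (n t : ℕ) → Continuation A₁ Z₁ n t →
    PolicyTree A₂ Z₂ n → Omega₁ S A₁ Z₁ t → ℝ
  | 0, _, _, _ => fun _ => 0
  | n + 1, t, (d, π), (a₂, κ) => fun (s, h₁) => ∑ a₁, (d h₁).1 a₁ *
      M.backProject a₂ (fun z₂ => alpha₁ M n (t + 1) π (κ z₂)) (s, h₁, a₁)

/-- The analogue of `alpha₁` at sub-stage `(2, t)`: the action of player 1 at stage `t` is already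
chosen, `π` starts at stage `t + 1`, and `κ` starts at stage `t`. -/
def alpha₂ (M : ZsPOSG S A₁ A₂ Z₁ Z₂) (n t : ℕ) (π : Continuation A₁ Z₁ n (t + 1))
    (κ : PolicyTree A₂ Z₂ (n + 1)) : Omega₂ S A₁ Z₁ t → ℝ :=
  M.backProject κ.1 (fun z₂ => M.alpha₁ n (t + 1) π (κ.2 z₂))

/-- Continuation policies of player 1 from sub-stage `(1, t)`: rules for the stages
`t, …, ℓ - 1`. -/
abbrev Pi₁ (M : ZsPOSG S A₁ A₂ Z₁ Z₂) (t : ℕ) : Type _ := Continuation A₁ Z₁ (M.ℓ - t) t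

/-- Continuation policies of player 1 from sub-stage `(2, t)`: rules for the stages
`t + 1, …, ℓ - 1`. -/
abbrev Pi₂ (M : ZsPOSG S A₁ A₂ Z₁ Z₂) (t : ℕ) : Type _ :=
  Continuation A₁ Z₁ (M.ℓ - (t + 1)) (t + 1)

/-- The set `Γ₂` of value vectors at sub-stage `(1, t)` induced by the continuation `π`, one for
each deterministic tree of player 2. -/
def envelope₁ (M : ZsPOSG S A₁ A₂ Z₁ Z₂) (t : ℕ) (π : M.Pi₁ t) :
    Set (Omega₁ S A₁ Z₁ t → ℝ) :=
  Set.range (M.alpha₁ (M.ℓ - t) t π)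

/-- The set `Γ₂` of value vectors at sub-stage `(2, t)` induced by the continuation `π`. -/
def envelope₂ (M : ZsPOSG S A₁ A₂ Z₁ Z₂) (t : ℕ) (π : M.Pi₂ t) :
    Set (Omega₂ S A₁ Z₁ t → ℝ) :=
  Set.range (M.alpha₂ (M.ℓ - (t + 1)) t π)

end ZsPOSG

end

set_option linter.unusedSectionVars false

noncomputable section

/-! ### Minima of finite families of reals, and maximal elements of compact sets -/

section Generic

/-! Backward induction shows that the value is the maximum of `Val` over all continuations of player
1. At a sub-stage of player 1 the maxima over the present rule and over the later ones merge into
one. At a sub-stage of player 2 the Bellman equation gives a minimum over rules of a maximum over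
continuations, and the two must be exchanged.

The exchange is Sion's minimax theorem. Player 1's variable is not the continuation but the whole
family of value vectors it induces, indexed by the trees of player 2. The set of these families is
compact, and convex by Kuhn's theorem (`exists_alpha₁_eq_mix`): one continuation realises a mixture
against all trees at once. The payoff `ruleValue` is concave in the family, being built from minima
of linear forms, and linear in the rule of player 2, because `Val` is positively homogeneous on each
slice (`reward₂_add_Val_trans₂`). For a fixed family a pure rule is optimal, and the minimum is
`Val` of the back-projected family.

Discarding dominated continuations loses nothing (`exists_best_not_dominated`): by compactness,
among the families optimal at `x` one has a maximal profile of values over all occupancies. -/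

theorem continuous_ciInf_of_finite {X ι : Type*} [TopologicalSpace X] [Finite ι] [Nonempty ι]
    {f : ι → X → ℝ} (hf : ∀ i, Continuous (f i)) : Continuous fun x => ⨅ i, f i x := by
  have := Fintype.ofFinite ι
  simp only [← Finset.inf'_univ_eq_ciInf]
  exact Continuous.finset_inf'_apply _ fun i _ => hf i

theorem sum_ciInf_eq_ciInf_sum {ι J : Type*} [Finite ι] [Nonempty ι] [Fintype J]
    (f : J → ι → ℝ) : ∑ j, ⨅ i, f j i = ⨅ g : J → ι, ∑ j, f j (g j) := by
  refine le_antisymm (le_ciInf fun g => Finset.sum_le_sum fun j _ =>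
    ciInf_le (Finite.bddBelow_range _) _) ?_
  choose g hg using fun j => exists_eq_ciInf_of_finite (f := f j)
  refine (ciInf_le (Finite.bddBelow_range _) g).trans_eq ?_
  simp only [hg]

theorem add_ciInf_of_finite {ι : Type*} [Finite ι] [Nonempty ι] (c : ℝ) (f : ι → ℝ) :
    c + ⨅ i, f i = ⨅ i, (c + f i) := by
  refine le_antisymm (le_ciInf fun i => by gcongr; exact ciInf_le (Finite.bddBelow_range _) _) ?_
  obtain ⟨i, hi⟩ := exists_eq_ciInf_of_finite (f := f)
  rw [← hi]
  exact ciInf_le (Finite.bddBelow_range _) i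

theorem concaveOn_ciInf_dotProduct {Ω K : Type*} [Fintype Ω] [Finite K] [Nonempty K]
    {C : Set (K → Ω → ℝ)} (hC : Convex ℝ C) (w : Ω → ℝ) :
    ConcaveOn ℝ C fun β => ⨅ κ, w ⬝ᵥ β κ := by
  refine ⟨hC, fun β _ β' _ a b ha hb _ => le_ciInf fun κ => ?_⟩
  simp only [Pi.add_apply, Pi.smul_apply, dotProduct_add, dotProduct_smul]
  gcongr <;> exact ciInf_le (Finite.bddBelow_range _) κ

/-- By Zorn's lemma: the closed up-sets of the members of a chain in `s` have the finite
intersection property in `s`, and a common point bounds the chain. -/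
theorem IsCompact.exists_maximal_mem {α : Type*} [PartialOrder α] [TopologicalSpace α]
    [ClosedIciTopology α] {s : Set α} (hs : IsCompact s) (hne : s.Nonempty) :
    ∃ m, Maximal (· ∈ s) m := by
  obtain ⟨x, hx⟩ := hne
  refine (zorn_le_nonempty₀ s (fun c hcs hc y hy => ?_) x hx).imp fun m hm => hm.2
  have : Nonempty c := ⟨⟨y, hy⟩⟩
  obtain ⟨u, hu, hu'⟩ := hs.inter_iInter_nonempty (fun z : c => Set.Ici z.1)
    (fun z => isClosed_Ici) fun F => by
      obtain ⟨z, hz⟩ := hc.directedOn.directed_val.finset_le F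
      exact ⟨z, hcs z.2, Set.mem_iInter₂.2 fun i hi => hz i hi⟩
  exact ⟨u, hu, fun z hz => Set.mem_iInter.1 hu' ⟨z, hz⟩⟩

end Generic

/-! ### Envelopes generated by a compact family of value vectors -/

section CompactEnvelope

variable {Ω H K P : Type*} [Fintype Ω] [Fintype H]

theorem Val_range (β : K → Ω → ℝ) (x : Ω × H → ℝ) :
    Val (Set.range β) x = ∑ h, ⨅ κ, slice x h ⬝ᵥ β κ := by
  simp only [Val, ← Set.range_comp]
  rfl

theorem continuous_Val_range [Finite K] [Nonempty K] (x : Ω × H → ℝ) :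
    Continuous fun β : K → Ω → ℝ => Val (Set.range β) x := by
  simp only [Val_range]
  refine continuous_finsetSum _ fun h _ => continuous_ciInf_of_finite fun κ => ?_
  simp only [dotProduct]
  fun_prop

/-- Some best continuation at `x` is neither dominated nor Pareto-dominated. -/
theorem exists_best_not_dominated [Finite K] [Nonempty K] {B : P → K → Ω → ℝ}
    (hB : IsCompact (Set.range B)) {x : Ω × H → ℝ} (hx : x ∈ stdSimplex ℝ (Ω × H)) {v : ℝ}
    (hv : IsGreatest (Set.range fun π => Val (Set.range (B π)) x) v) :
    ∃ π, Val (Set.range (B π)) x = v ∧ ¬ IsDominated H (fun π => Set.range (B π)) π ∧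
      ¬ IsParetoDominated H (fun π => Set.range (B π)) π := by
  -- The profile of values over all occupancies; its pointwise order is the weak inequality in
  -- Pareto domination.
  let Φ : (K → Ω → ℝ) → stdSimplex ℝ (Ω × H) → ℝ := fun β y => Val (Set.range β) y.1
  have hΦ : Continuous Φ := continuous_pi fun y => continuous_Val_range y.1
  let D : Set (K → Ω → ℝ) := Set.range B ∩ {β | Val (Set.range β) x = v}
  have hD : IsCompact D := hB.inter_right (isClosed_eq (continuous_Val_range x) continuous_const)
  have hne : D.Nonempty := by
    obtain ⟨⟨π, hπ⟩, -⟩ := hv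
    exact ⟨B π, ⟨π, rfl⟩, hπ⟩
  obtain ⟨_, ⟨⟨_, ⟨⟨π, rfl⟩, hπv⟩, rfl⟩, hmax⟩⟩ :=
    (hD.image hΦ).exists_maximal_mem (hne.image Φ)
  refine ⟨π, hπv, fun hdom => ?_, ?_⟩
  · obtain ⟨π', hπ'⟩ := hdom x hx
    exact (hπv ▸ hπ').not_ge (hv.2 ⟨π', rfl⟩)
  · rintro ⟨π', hle, y, hy, hlt⟩
    -- A Pareto-dominator of an optimum at `x` is again optimal at `x`, so it competes within `D`,
    -- where the profile of `π` is maximal.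
    have hv' : Val (Set.range (B π')) x = v :=
      le_antisymm (hv.2 ⟨π', rfl⟩) (hπv ▸ hle x hx)
    exact hlt.not_ge (hmax ⟨B π', ⟨⟨π', rfl⟩, hv'⟩, rfl⟩ (fun z => hle z.1 z.2) ⟨y, hy⟩)

theorem RepresentsNonDominated.isGreatest [Finite K] [Nonempty K] {B : P → K → Ω → ℝ}
    (hB : IsCompact (Set.range B)) {Γ₁ : Set (Set (Ω → ℝ))}
    (hΓ : RepresentsNonDominated H (fun π => Set.range (B π)) Γ₁)
    {x : Ω × H → ℝ} (hx : x ∈ stdSimplex ℝ (Ω × H)) {v : ℝ}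
    (hv : IsGreatest (Set.range fun π => Val (Set.range (B π)) x) v) :
    IsGreatest ((fun Γ₂ => Val Γ₂ x) '' Γ₁) v := by
  obtain ⟨π, hπv, hd, hp⟩ := exists_best_not_dominated hB hx hv
  refine ⟨⟨_, hΓ.2 π hd hp, hπv⟩, ?_⟩
  rintro _ ⟨Γ₂, hΓ₂, rfl⟩
  obtain ⟨π', rfl⟩ := hΓ.1 hΓ₂
  exact hv.2 ⟨π', rfl⟩

theorem RepresentsNonDominated.finite_nonempty [Finite K] [Nonempty K] {B : P → K → Ω → ℝ}
    {Γ₁ : Set (Set (Ω → ℝ))} (hΓ : RepresentsNonDominated H (fun π => Set.range (B π)) Γ₁)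
    {Γ₂ : Set (Ω → ℝ)} (hΓ₂ : Γ₂ ∈ Γ₁) : Γ₂.Finite ∧ Γ₂.Nonempty := by
  obtain ⟨π, rfl⟩ := hΓ.1 hΓ₂
  exact ⟨Set.finite_range _, Set.range_nonempty _⟩

end CompactEnvelope

/-! ### Policy trees and continuations -/

theorem PolicyTree.nonempty (A : Type u) (Z : Type v) [Nonempty A] :
    ∀ n, Nonempty (PolicyTree A Z n)
  | 0 => inferInstanceAs (Nonempty PUnit)
  | n + 1 =>
    have := PolicyTree.nonempty A Z n
    inferInstanceAs (Nonempty (A × (Z → PolicyTree A Z n)))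

theorem PolicyTree.finite (A : Type u) (Z : Type v) [Finite A] [Finite Z] :
    ∀ n, Finite (PolicyTree A Z n)
  | 0 => inferInstanceAs (Finite PUnit)
  | n + 1 =>
    have := PolicyTree.finite A Z n
    inferInstanceAs (Finite (A × (Z → PolicyTree A Z n)))

theorem Continuation.nonempty (A : Type u) (Z : Type v) [Fintype A] [Nonempty A] :
    ∀ n t, Nonempty (Continuation A Z n t)
  | 0, _ => inferInstanceAs (Nonempty PUnit)
  | n + 1, t =>
    have := Continuation.nonempty A Z n (t + 1)
    inferInstanceAs (Nonempty (DecisionRule A Z t × Continuation A Z n (t + 1)))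

attribute [instance] PolicyTree.nonempty PolicyTree.finite Continuation.nonempty

namespace ZsPOSG

variable {S A₁ A₂ Z₁ Z₂ : Type*} [Fintype S] [Fintype A₁] [Fintype A₂] [Fintype Z₁] [Fintype Z₂]

/-! ### The set of value vectors of player 1 is convex and compact -/

theorem alpha₁_succ (M : ZsPOSG S A₁ A₂ Z₁ Z₂) (n t : ℕ) (d : DecisionRule A₁ Z₁ t)
    (π : Continuation A₁ Z₁ n (t + 1)) (κ : PolicyTree A₂ Z₂ (n + 1))
    (s : S) (h₁ : Hist A₁ Z₁ t) :
    M.alpha₁ (n + 1) t (d, π) κ (s, h₁) =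
      ∑ a₁, (d h₁).1 a₁ * M.alpha₂ n t π κ (s, h₁, a₁) := rfl

/-- The posterior weight of the first of two rules mixed with prior weight `w`, given that the
action had the probabilities `p` and `q` under them. -/
def posterior (w p q : ℝ) : ℝ := w * p / (w * p + (1 - w) * q)

theorem posterior_mem_Icc {w p q : ℝ} (hw : w ∈ Set.Icc (0 : ℝ) 1) (hp : 0 ≤ p) (hq : 0 ≤ q) :
    posterior w p q ∈ Set.Icc (0 : ℝ) 1 := by
  have h₁ : 0 ≤ w * p := mul_nonneg hw.1 hp
  have h₂ : 0 ≤ (1 - w) * q := mul_nonneg (sub_nonneg.2 hw.2) hq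
  exact ⟨div_nonneg h₁ (add_nonneg h₁ h₂), div_le_one_of_le₀ (by linarith) (add_nonneg h₁ h₂)⟩

theorem mul_posterior {w p q : ℝ} (hw : w ∈ Set.Icc (0 : ℝ) 1) (hp : 0 ≤ p) (hq : 0 ≤ q) :
    (w * p + (1 - w) * q) * posterior w p q = w * p := by
  have h₁ : 0 ≤ w * p := mul_nonneg hw.1 hp
  have h₂ : 0 ≤ (1 - w) * q := mul_nonneg (sub_nonneg.2 hw.2) hq
  by_cases h : w * p + (1 - w) * q = 0
  -- A vanishing sum of two nonnegative terms forces `w * p = 0`, so the default value of the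
  -- division is harmless.
  · rw [h, zero_mul]; linarith
  · exact mul_div_cancel₀ _ h

/-- Kuhn's theorem for two continuations: the mixture of `π` and `π'` with a weight that depends
on the present history of player 1 is realised by a continuation. -/
theorem exists_alpha₁_eq_mix (M : ZsPOSG S A₁ A₂ Z₁ Z₂) (n : ℕ) : ∀ (t : ℕ)
    (π π' : Continuation A₁ Z₁ n t) (w : Hist A₁ Z₁ t → ℝ), (∀ h, w h ∈ Set.Icc (0 : ℝ) 1) →
    ∃ π'' : Continuation A₁ Z₁ n t, ∀ κ s h, M.alpha₁ n t π'' κ (s, h) =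
      w h * M.alpha₁ n t π κ (s, h) + (1 - w h) * M.alpha₁ n t π' κ (s, h) := by
  induction n with
  | zero => exact fun t π _ w _ => ⟨π, fun κ s h => by simp [alpha₁]⟩
  | succ n ih =>
    rintro t ⟨d, π⟩ ⟨d', π'⟩ w hw
    let d'' : DecisionRule A₁ Z₁ t := fun h =>
      ⟨w h • (d h).1 + (1 - w h) • (d' h).1, convex_stdSimplex ℝ A₁ (d h).2 (d' h).2 (hw h).1
        (sub_nonneg.2 (hw h).2) (add_sub_cancel _ _)⟩
    -- Player 1's action carries information on which continuation was drawn, so the later mixture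
    -- uses the posterior weight. This is why `w` must be allowed to depend on the history. The
    -- observation adds no information, its law being the same under both.
    obtain ⟨π'', hπ''⟩ := ih (t + 1) π π'
      (fun h => posterior (w h.init) ((d h.init).1 h.lastAct) ((d' h.init).1 h.lastAct))
      (fun h => posterior_mem_Icc (hw _) ((d _).2.1 _) ((d' _).2.1 _))
    refine ⟨(d'', π''), fun κ s h => ?_⟩
    simp only [alpha₁_succ, Finset.mul_sum, ← Finset.sum_add_distrib]
    refine Finset.sum_congr rfl fun a _ => ?_
    have hd : (d'' h).1 a = w h * (d h).1 a + (1 - w h) * (d' h).1 a := rfl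
    have hm := mul_posterior (hw h) ((d h).2.1 a) ((d' h).2.1 a)
    rw [← hd] at hm
    set ν := posterior (w h) ((d h).1 a) ((d' h).1 a)
    have hα : M.alpha₂ n t π'' κ (s, h, a) =
        ν * M.alpha₂ n t π κ (s, h, a) + (1 - ν) * M.alpha₂ n t π' κ (s, h, a) := by
      simp only [alpha₂, backProject, hπ'', Hist.init_snoc, Hist.lastAct_snoc, ν, mul_add,
        Finset.mul_sum]
      rw [add_add_add_comm, ← Finset.sum_add_distrib]
      congr 1
      · ring
      · exact Finset.sum_congr rfl fun o _ => by ring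
    rw [hα]
    linear_combination (M.alpha₂ n t π κ (s, h, a) - M.alpha₂ n t π' κ (s, h, a)) * hm +
      M.alpha₂ n t π' κ (s, h, a) * hd

theorem convex_range_alpha₁ (M : ZsPOSG S A₁ A₂ Z₁ Z₂) (n t : ℕ) :
    Convex ℝ (Set.range (M.alpha₁ n t)) := by
  rintro _ ⟨π, rfl⟩ _ ⟨π', rfl⟩ a b ha hb hab
  obtain ⟨π'', h⟩ := M.exists_alpha₁_eq_mix n t π π' (fun _ => a) fun _ => ⟨ha, by linarith⟩
  refine ⟨π'', funext fun κ => funext fun ω => ?_⟩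
  rw [h, ← hab, add_sub_cancel_left]
  rfl

/-- `backProject` as a map from families of value vectors indexed by `K` to families indexed by
`A₂ × (Z₂ → K)`. -/
def backProjectFamily (M : ZsPOSG S A₁ A₂ Z₁ Z₂) {t : ℕ} {K : Type*}
    (β : K → Omega₁ S A₁ Z₁ (t + 1) → ℝ) (κ : A₂ × (Z₂ → K)) : Omega₂ S A₁ Z₁ t → ℝ :=
  M.backProject κ.1 fun z₂ => β (κ.2 z₂)

theorem continuous_backProjectFamily (M : ZsPOSG S A₁ A₂ Z₁ Z₂) {t : ℕ} {K : Type*} :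
    Continuous (M.backProjectFamily (t := t) (K := K)) := by
  refine continuous_pi fun κ => continuous_pi fun ω => ?_
  simp only [backProjectFamily, backProject]
  fun_prop

/-- By recursion the set is the continuous image of the compact space of rules times the
corresponding set at the next stage; no topology on continuations is needed. -/
theorem isCompact_range_alpha₁ (M : ZsPOSG S A₁ A₂ Z₁ Z₂) (n : ℕ) :
    ∀ t, IsCompact (Set.range (M.alpha₁ n t)) := by
  induction n with
  | zero => exact fun t => (Set.finite_range (ι := PUnit) (M.alpha₁ 0 t)).isCompact
  | succ n ih =>
    intro t
    let Φ : DecisionRule A₁ Z₁ t × (PolicyTree A₂ Z₂ n → Omega₁ S A₁ Z₁ (t + 1) → ℝ) →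
        PolicyTree A₂ Z₂ (n + 1) → Omega₁ S A₁ Z₁ t → ℝ :=
      fun q κ ω => ∑ a₁, (q.1 ω.2).1 a₁ * M.backProjectFamily q.2 κ (ω.1, ω.2, a₁)
    have hΦ : Continuous Φ := by
      refine continuous_pi fun κ => continuous_pi fun ω => continuous_finsetSum _ fun a _ => ?_
      refine Continuous.mul ?_ ?_
      · exact (continuous_apply a).comp
          (continuous_subtype_val.comp ((continuous_apply ω.2).comp continuous_fst))
      · exact (continuous_apply _).comp ((continuous_apply (A := fun _ => _) κ).comp
          (M.continuous_backProjectFamily.comp continuous_snd))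
    have himg : Set.range (M.alpha₁ (n + 1) t) =
        Φ '' (Set.univ ×ˢ Set.range (M.alpha₁ n (t + 1))) := by
      ext α
      constructor
      · rintro ⟨⟨d, π⟩, rfl⟩
        exact ⟨(d, _), ⟨trivial, π, rfl⟩, rfl⟩
      · rintro ⟨⟨d, _⟩, ⟨-, π, rfl⟩, rfl⟩
        exact ⟨(d, π), rfl⟩
    rw [himg]
    exact (isCompact_univ.prod (ih (t + 1))).image hΦ

theorem isCompact_range_alpha₂ (M : ZsPOSG S A₁ A₂ Z₁ Z₂) (n t : ℕ) :
    IsCompact (Set.range (M.alpha₂ n t)) := by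
  have h : Set.range (M.alpha₂ n t) = M.backProjectFamily '' Set.range (M.alpha₁ n (t + 1)) := by
    rw [← Set.range_comp]
    rfl
  rw [h]
  exact (M.isCompact_range_alpha₁ n (t + 1)).image M.continuous_backProjectFamily

/-! ### One step of player 2 -/

/-- The unnormalised slice at stage `t + 1` reached from the slice `w` at sub-stage `(2, t)` when
player 2 plays `a₂` and observes `z₂`. -/
def nextSlice (M : ZsPOSG S A₁ A₂ Z₁ Z₂) {t : ℕ} (w : Omega₂ S A₁ Z₁ t → ℝ) (a₂ : A₂) (z₂ : Z₂) :
    Omega₁ S A₁ Z₁ (t + 1) → ℝ :=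
  fun (s', h₁) => ∑ s, w (s, h₁.init, h₁.lastAct) * M.p s h₁.lastAct a₂ (s', h₁.lastObs, z₂)

/-- The expected stage payoff on the slice `w` when player 2 plays `a₂`. -/
def sliceReward (M : ZsPOSG S A₁ A₂ Z₁ Z₂) {t : ℕ} (w : Omega₂ S A₁ Z₁ t → ℝ) (a₂ : A₂) : ℝ :=
  ∑ ω : Omega₂ S A₁ Z₁ t, w ω * M.r ω.1 ω.2.2 a₂

/-- The payoff on the slice `w` when player 2 plays `a₂` and then, after each observation, a best
member of the family `β`. -/
def actionValue (M : ZsPOSG S A₁ A₂ Z₁ Z₂) {t : ℕ} {K : Type*} (w : Omega₂ S A₁ Z₁ t → ℝ)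
    (a₂ : A₂) (β : K → Omega₁ S A₁ Z₁ (t + 1) → ℝ) : ℝ :=
  M.sliceReward w a₂ + M.γ * ∑ z₂, ⨅ κ, M.nextSlice w a₂ z₂ ⬝ᵥ β κ

theorem dotProduct_backProject (M : ZsPOSG S A₁ A₂ Z₁ Z₂) {t : ℕ} (w : Omega₂ S A₁ Z₁ t → ℝ)
    (a₂ : A₂) (β : Z₂ → Omega₁ S A₁ Z₁ (t + 1) → ℝ) :
    w ⬝ᵥ M.backProject a₂ β =
      M.sliceReward w a₂ + M.γ * ∑ z₂, M.nextSlice w a₂ z₂ ⬝ᵥ β z₂ := by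
  -- Reorders the summation once a history of stage `t + 1` is split into its initial part, last
  -- action and last observation.
  let e : Z₂ × S × (Hist A₁ Z₁ t × A₁ × Z₁) × S ≃
      (S × Hist A₁ Z₁ t × A₁) × S × Z₁ × Z₂ :=
    { toFun := fun q => ((q.2.2.2, q.2.2.1.1, q.2.2.1.2.1), q.2.1, q.2.2.1.2.2, q.1)
      invFun := fun q => (q.2.2.2, q.2.1, (q.1.2.1, q.1.2.2, q.2.2.1), q.1.1)
      left_inv := fun _ => rfl
      right_inv := fun _ => rfl }
  have key := Fintype.sum_equiv e
    (fun q => w (q.2.2.2, q.2.2.1.1, q.2.2.1.2.1) *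
      M.p q.2.2.2 q.2.2.1.2.1 a₂ (q.2.1, q.2.2.1.2.2, q.1) *
      β q.1 (q.2.1, q.2.2.1.1.snoc q.2.2.1.2.1 q.2.2.1.2.2))
    (fun q => w q.1 * M.p q.1.1 q.1.2.2 a₂ q.2 * β q.2.2.2 (q.2.1, q.1.2.1.snoc q.1.2.2 q.2.2.1))
    (fun _ => rfl)
  have hl : w ⬝ᵥ M.backProject a₂ β = M.sliceReward w a₂ + M.γ *
      ∑ q : (S × Hist A₁ Z₁ t × A₁) × S × Z₁ × Z₂,
        w q.1 * M.p q.1.1 q.1.2.2 a₂ q.2 * β q.2.2.2 (q.2.1, q.1.2.1.snoc q.1.2.2 q.2.2.1) := by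
    rw [Fintype.sum_prod_type, sliceReward, Finset.mul_sum, ← Finset.sum_add_distrib]
    refine Finset.sum_congr rfl fun ω _ => ?_
    simp only [backProject, mul_add, Finset.mul_sum]
    congr 1
    exact Finset.sum_congr rfl fun o _ => by ring
  rw [hl, ← key]
  simp only [Fintype.sum_prod_type, dotProduct, nextSlice, Hist.sum_snoc, Hist.init_snoc,
    Hist.lastAct_snoc, Hist.lastObs_snoc, Finset.sum_mul]

/-- The subtrees after different observations are chosen independently, so the minimum of the sum
over observations is the sum of the minima; it passes through the factor `γ` because `γ ≥ 0`. -/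
theorem ciInf_dotProduct_backProjectFamily [Nonempty A₂] (M : ZsPOSG S A₁ A₂ Z₁ Z₂) {t : ℕ}
    {K : Type*} [Finite K] [Nonempty K] (w : Omega₂ S A₁ Z₁ t → ℝ)
    (β : K → Omega₁ S A₁ Z₁ (t + 1) → ℝ) :
    ⨅ κ, w ⬝ᵥ M.backProjectFamily β κ = ⨅ a₂, M.actionValue w a₂ β := by
  simp only [backProjectFamily, dotProduct_backProject, actionValue, sum_ciInf_eq_ciInf_sum,
    Real.mul_iInf_of_nonneg M.γ_nonneg, add_ciInf_of_finite]
  exact ciInf_prod (Finite.bddBelow_range _)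

theorem Val_backProjectFamily [Nonempty A₂] (M : ZsPOSG S A₁ A₂ Z₁ Z₂) {t : ℕ}
    {K : Type*} [Finite K] [Nonempty K] (β : K → Omega₁ S A₁ Z₁ (t + 1) → ℝ)
    (x : Omega₂ S A₁ Z₁ t × Hist A₂ Z₂ t → ℝ) :
    Val (Set.range (M.backProjectFamily β)) x = ∑ h, ⨅ a₂, M.actionValue (slice x h) a₂ β := by
  simp only [Val_range, ciInf_dotProduct_backProjectFamily]

/-- The payoff from `x` when player 2 plays the randomised rule `d` and then a best member of
`β`. -/
def ruleValue (M : ZsPOSG S A₁ A₂ Z₁ Z₂) {t : ℕ} {K : Type*}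
    (x : Omega₂ S A₁ Z₁ t × Hist A₂ Z₂ t → ℝ) (d : Hist A₂ Z₂ t → A₂ → ℝ)
    (β : K → Omega₁ S A₁ Z₁ (t + 1) → ℝ) : ℝ :=
  ∑ h, ∑ a₂, d h a₂ * M.actionValue (slice x h) a₂ β

/-- Player 2 remembers the action played, so the slice after `(h, a, z)` is a slice independent of
`d` scaled by the probability of `a`. This nonnegative factor leaves the minimum, which makes the
payoff linear in `d`. -/
theorem reward₂_add_Val_trans₂ (M : ZsPOSG S A₁ A₂ Z₁ Z₂) {t : ℕ} {K : Type*}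
    (β : K → Omega₁ S A₁ Z₁ (t + 1) → ℝ)
    (x : Omega₂ S A₁ Z₁ t × Hist A₂ Z₂ t → ℝ) (d : DecisionRule A₂ Z₂ t) :
    M.reward₂ x d + M.γ * Val (Set.range β) (M.trans₂ x d) =
      M.ruleValue x (fun h => (d h).1) β := by
  have hs : ∀ (h : Hist A₂ Z₂ t) a z, slice (M.trans₂ x d) (h.snoc a z) =
      (d h).1 a • M.nextSlice (slice x h) a z := by
    intro h a z
    funext ω
    simp only [slice, trans₂, nextSlice, Hist.init_snoc, Hist.lastAct_snoc, Hist.lastObs_snoc,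
      Pi.smul_apply, smul_eq_mul, Finset.mul_sum]
    exact Finset.sum_congr rfl fun s _ => by ring
  have hr : M.reward₂ x d = ∑ h, ∑ a, (d h).1 a * M.sliceReward (slice x h) a := by
    rw [reward₂, Fintype.sum_prod_type_right]
    refine Finset.sum_congr rfl fun h _ => ?_
    rw [Finset.sum_comm]
    simp only [sliceReward, Finset.mul_sum]
    exact Finset.sum_congr rfl fun a _ => Finset.sum_congr rfl fun ω _ => by
      simp only [slice]; ring
  rw [hr, Val_range, Hist.sum_snoc]
  simp only [hs, smul_dotProduct, smul_eq_mul, ← Real.mul_iInf_of_nonneg ((d _).2.1 _),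
    ← Finset.mul_sum, ruleValue, actionValue]
  rw [Finset.mul_sum, ← Finset.sum_add_distrib]
  refine Finset.sum_congr rfl fun h _ => ?_
  rw [Finset.mul_sum, ← Finset.sum_add_distrib]
  exact Finset.sum_congr rfl fun a _ => by ring

/-! ### Exchanging the minimum over rules of player 2 with the maximum over value vectors -/

theorem continuous_actionValue (M : ZsPOSG S A₁ A₂ Z₁ Z₂) {t : ℕ} {K : Type*} [Finite K]
    [Nonempty K] (w : Omega₂ S A₁ Z₁ t → ℝ) (a₂ : A₂) :
    Continuous fun β : K → Omega₁ S A₁ Z₁ (t + 1) → ℝ => M.actionValue w a₂ β := by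
  refine continuous_const.add (continuous_const.mul (continuous_finsetSum _ fun z _ =>
    continuous_ciInf_of_finite fun κ => ?_))
  simp only [dotProduct]
  fun_prop

theorem concaveOn_actionValue (M : ZsPOSG S A₁ A₂ Z₁ Z₂) {t : ℕ} {K : Type*} [Finite K]
    [Nonempty K] {C : Set (K → Omega₁ S A₁ Z₁ (t + 1) → ℝ)} (hC : Convex ℝ C)
    (w : Omega₂ S A₁ Z₁ t → ℝ) (a₂ : A₂) :
    ConcaveOn ℝ C fun β => M.actionValue w a₂ β := by
  refine ConcaveOn.add (concaveOn_const _ hC) (ConcaveOn.smul M.γ_nonneg ?_)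
  refine ⟨hC, fun β hβ β' hβ' a b ha hb hab => ?_⟩
  simp only [Finset.smul_sum, ← Finset.sum_add_distrib]
  exact Finset.sum_le_sum fun z _ =>
    (concaveOn_ciInf_dotProduct hC (M.nextSlice w a₂ z)).2 hβ hβ' ha hb hab

theorem concaveOn_ruleValue (M : ZsPOSG S A₁ A₂ Z₁ Z₂) {t : ℕ} {K : Type*} [Finite K]
    [Nonempty K] {C : Set (K → Omega₁ S A₁ Z₁ (t + 1) → ℝ)} (hC : Convex ℝ C)
    (x : Omega₂ S A₁ Z₁ t × Hist A₂ Z₂ t → ℝ) {d : Hist A₂ Z₂ t → A₂ → ℝ}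
    (hd : ∀ h a, 0 ≤ d h a) : ConcaveOn ℝ C fun β => M.ruleValue x d β := by
  refine ⟨hC, fun β hβ β' hβ' a b ha hb hab => ?_⟩
  simp only [ruleValue, Finset.smul_sum, ← Finset.sum_add_distrib]
  exact Finset.sum_le_sum fun h _ => Finset.sum_le_sum fun a₂ _ =>
    ((M.concaveOn_actionValue hC (slice x h) a₂).smul (hd h a₂)).2 hβ hβ' ha hb hab

theorem exists_saddlePoint_ruleValue [Nonempty A₂] (M : ZsPOSG S A₁ A₂ Z₁ Z₂) {t : ℕ}
    {K : Type*} [Finite K] [Nonempty K] {C : Set (K → Omega₁ S A₁ Z₁ (t + 1) → ℝ)}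
    (hC : Convex ℝ C) (hC' : IsCompact C) (hne : C.Nonempty)
    (x : Omega₂ S A₁ Z₁ t × Hist A₂ Z₂ t → ℝ) :
    ∃ d₀ : DecisionRule A₂ Z₂ t, ∃ β₀ ∈ C, ∀ d : DecisionRule A₂ Z₂ t, ∀ β ∈ C,
      M.ruleValue x (fun h => (d₀ h).1) β ≤ M.ruleValue x (fun h => (d h).1) β₀ := by
  -- Sion's theorem needs a convex subset of a vector space, hence rules as real functions in a
  -- product of simplices.
  let X : Set (Hist A₂ Z₂ t → A₂ → ℝ) := Set.univ.pi fun _ => stdSimplex ℝ A₂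
  have hX : Convex ℝ X := convex_pi fun _ _ => convex_stdSimplex ℝ A₂
  have hX' : IsCompact X := isCompact_univ_pi fun _ => isCompact_stdSimplex ℝ A₂
  have hXne : X.Nonempty :=
    Set.univ_pi_nonempty_iff.2 fun _ => Set.nonempty_coe_sort.1 inferInstance
  obtain ⟨d₀, hd₀, β₀, hβ₀, hsaddle⟩ := Sion.exists_isSaddlePointOn (f := M.ruleValue x)
    hXne hX hX'
    (fun β _ => Continuous.lowerSemicontinuous (by
      simp only [ruleValue]; fun_prop) |>.lowerSemicontinuousOn _)
    (fun β _ => ConvexOn.quasiconvexOn ⟨hX, fun d _ d' _ a b _ _ _ => le_of_eq (by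
      simp only [ruleValue, Pi.add_apply, Pi.smul_apply, add_mul, smul_eq_mul, mul_assoc,
        Finset.sum_add_distrib, Finset.mul_sum])⟩)
    hC hne hC'
    (fun d _ => Continuous.upperSemicontinuous (continuous_finsetSum _ fun h _ =>
      continuous_finsetSum _ fun a _ => continuous_const.mul (M.continuous_actionValue _ a))
      |>.upperSemicontinuousOn _)
    (fun d hd => (M.concaveOn_ruleValue hC x fun h a => (hd h trivial).1 a).quasiconcaveOn)
  exact ⟨fun h => ⟨d₀ h, hd₀ h trivial⟩, β₀, hβ₀, fun d β hβ =>
    hsaddle _ (fun h _ => (d h).2) β hβ⟩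

theorem sum_ciInf_actionValue_le_ruleValue (M : ZsPOSG S A₁ A₂ Z₁ Z₂) {t : ℕ} {K : Type*}
    (x : Omega₂ S A₁ Z₁ t × Hist A₂ Z₂ t → ℝ) (d : DecisionRule A₂ Z₂ t)
    (β : K → Omega₁ S A₁ Z₁ (t + 1) → ℝ) :
    ∑ h, ⨅ a₂, M.actionValue (slice x h) a₂ β ≤ M.ruleValue x (fun h => (d h).1) β := by
  refine Finset.sum_le_sum fun h _ => ?_
  rw [← one_mul (⨅ a₂, _), ← (d h).2.2, Finset.sum_mul]
  exact Finset.sum_le_sum fun a _ =>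
    mul_le_mul_of_nonneg_left (ciInf_le (Finite.bddBelow_range _) a) ((d h).2.1 a)

theorem exists_ruleValue_eq_sum_ciInf_actionValue [Nonempty A₂] (M : ZsPOSG S A₁ A₂ Z₁ Z₂)
    {t : ℕ} {K : Type*} (x : Omega₂ S A₁ Z₁ t × Hist A₂ Z₂ t → ℝ)
    (β : K → Omega₁ S A₁ Z₁ (t + 1) → ℝ) : ∃ d : DecisionRule A₂ Z₂ t,
    M.ruleValue x (fun h => (d h).1) β = ∑ h, ⨅ a₂, M.actionValue (slice x h) a₂ β := by
  classical
  choose g hg using fun h =>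
    exists_eq_ciInf_of_finite (f := fun a₂ => M.actionValue (slice x h) a₂ β)
  refine ⟨fun h => ⟨Pi.single (g h) 1, single_mem_stdSimplex ℝ (g h)⟩,
    Finset.sum_congr rfl fun h _ => ?_⟩
  rw [← hg]
  simp [Pi.single_apply]

/-! ### The value is the maximum over all continuations -/

/-- Both the min-max defining `bellman₂` and the max-min given by `Val` equal the payoff at the
saddle point `(d₀, π₀)`. -/
theorem isGreatest_bellman₂ [Nonempty A₁] [Nonempty A₂] (M : ZsPOSG S A₁ A₂ Z₁ Z₂) {n t : ℕ}
    {v : (Omega₁ S A₁ Z₁ (t + 1) × Hist A₂ Z₂ (t + 1) → ℝ) → ℝ}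
    (hv : ∀ x ∈ stdSimplex ℝ (Omega₁ S A₁ Z₁ (t + 1) × Hist A₂ Z₂ (t + 1)),
      IsGreatest (Set.range fun π => Val (Set.range (M.alpha₁ n (t + 1) π)) x) (v x))
    {x : Omega₂ S A₁ Z₁ t × Hist A₂ Z₂ t → ℝ}
    (hx : x ∈ stdSimplex ℝ (Omega₂ S A₁ Z₁ t × Hist A₂ Z₂ t)) :
    IsGreatest (Set.range fun π => Val (Set.range (M.alpha₂ n t π)) x) (M.bellman₂ v x) := by
  have hVal : ∀ π, Val (Set.range (M.alpha₂ n t π)) x =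
      ∑ h, ⨅ a₂, M.actionValue (slice x h) a₂ (M.alpha₁ n (t + 1) π) := fun π =>
    M.Val_backProjectFamily (M.alpha₁ n (t + 1) π) x
  obtain ⟨d₀, _, ⟨π₀, rfl⟩, hsaddle⟩ := M.exists_saddlePoint_ruleValue
    (M.convex_range_alpha₁ n (t + 1)) (M.isCompact_range_alpha₁ n (t + 1))
    (Set.range_nonempty _) x
  have hle : ∀ d π, M.ruleValue x (fun h => (d h).1) (M.alpha₁ n (t + 1) π) ≤
      M.reward₂ x d + M.γ * v (M.trans₂ x d) := fun d π => by
    rw [← reward₂_add_Val_trans₂]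
    gcongr
    · exact M.γ_nonneg
    · exact (hv _ (M.trans₂_mem hx d)).2 ⟨π, rfl⟩
  have hlow : ∀ d, M.ruleValue x (fun h => (d₀ h).1) (M.alpha₁ n (t + 1) π₀) ≤
      M.reward₂ x d + M.γ * v (M.trans₂ x d) := fun d =>
    (hsaddle d _ ⟨π₀, rfl⟩).trans (hle d π₀)
  have hval : M.bellman₂ v x = M.ruleValue x (fun h => (d₀ h).1) (M.alpha₁ n (t + 1) π₀) := by
    -- `hlow` also supplies the lower bound without which the real infimum would take a default
    -- value.
    refine le_antisymm ((ciInf_le ⟨_, Set.forall_mem_range.2 hlow⟩ d₀).trans ?_)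
      (le_ciInf hlow)
    obtain ⟨π, hπ⟩ := (hv _ (M.trans₂_mem hx d₀)).1
    rw [← hπ, reward₂_add_Val_trans₂]
    exact hsaddle d₀ _ ⟨π, rfl⟩
  have hup : ∀ π, Val (Set.range (M.alpha₂ n t π)) x ≤ M.bellman₂ v x := fun π => by
    rw [hVal, hval]
    exact (M.sum_ciInf_actionValue_le_ruleValue x d₀ _).trans (hsaddle d₀ _ ⟨π, rfl⟩)
  refine ⟨⟨π₀, le_antisymm (hup π₀) ?_⟩, Set.forall_mem_range.2 hup⟩
  -- Even a pure best reply of player 2 to `π₀` cannot push the payoff below the saddle value.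
  obtain ⟨d, hd⟩ := M.exists_ruleValue_eq_sum_ciInf_actionValue x (M.alpha₁ n (t + 1) π₀)
  simp only [hVal, hval, ← hd]
  exact hsaddle d _ ⟨π₀, rfl⟩

/-- Player 1's action is hidden from player 2, so the slices are still indexed by the same
histories, and the weights of `d` can be moved from the occupancy into the value vector. -/
theorem Val_trans₁ (M : ZsPOSG S A₁ A₂ Z₁ Z₂) (n t : ℕ) (d : DecisionRule A₁ Z₁ t)
    (π : Continuation A₁ Z₁ n (t + 1)) (x : Omega₁ S A₁ Z₁ t × Hist A₂ Z₂ t → ℝ) :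
    Val (Set.range (M.alpha₂ n t π)) (M.trans₁ x d) =
      Val (Set.range (M.alpha₁ (n + 1) t (d, π))) x := by
  simp only [Val_range]
  refine Finset.sum_congr rfl fun h _ => iInf_congr fun κ => ?_
  simp only [dotProduct, Fintype.sum_prod_type, slice, trans₁, alpha₁_succ, Finset.mul_sum,
    mul_assoc]

/-- A continuation is a pair of a rule and a later continuation, so the two successive maxima are
one maximum over pairs, attained by compactness. -/
theorem isGreatest_bellman₁ (M : ZsPOSG S A₁ A₂ Z₁ Z₂) [Nonempty A₁] [Nonempty A₂] {n t : ℕ}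
    {v : (Omega₂ S A₁ Z₁ t × Hist A₂ Z₂ t → ℝ) → ℝ}
    (hv : ∀ x ∈ stdSimplex ℝ (Omega₂ S A₁ Z₁ t × Hist A₂ Z₂ t),
      IsGreatest (Set.range fun π => Val (Set.range (M.alpha₂ n t π)) x) (v x))
    {x : Omega₁ S A₁ Z₁ t × Hist A₂ Z₂ t → ℝ}
    (hx : x ∈ stdSimplex ℝ (Omega₁ S A₁ Z₁ t × Hist A₂ Z₂ t)) :
    IsGreatest (Set.range fun π => Val (Set.range (M.alpha₁ (n + 1) t π)) x)
      (M.bellman₁ v x) := by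
  obtain ⟨_, ⟨π₀, rfl⟩, hmax⟩ := (M.isCompact_range_alpha₁ (n + 1) t).exists_isMaxOn
    (Set.range_nonempty _) (continuous_Val_range x).continuousOn
  have hmax' : ∀ π, Val (Set.range (M.alpha₁ (n + 1) t π)) x ≤
      Val (Set.range (M.alpha₁ (n + 1) t π₀)) x := fun π => hmax ⟨π, rfl⟩
  have hup : ∀ d, v (M.trans₁ x d) ≤ Val (Set.range (M.alpha₁ (n + 1) t π₀)) x := fun d => by
    obtain ⟨π, hπ⟩ := (hv _ (M.trans₁_mem hx d)).1
    rw [← hπ]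
    exact (M.Val_trans₁ n t d π x).trans_le (hmax' _)
  have hval : M.bellman₁ v x = Val (Set.range (M.alpha₁ (n + 1) t π₀)) x := by
    refine le_antisymm (ciSup_le hup) ?_
    refine le_trans ?_ (le_ciSup ⟨_, Set.forall_mem_range.2 hup⟩ π₀.1)
    exact (M.Val_trans₁ n t π₀.1 π₀.2 x).symm.trans_le
      ((hv _ (M.trans₁_mem hx π₀.1)).2 ⟨π₀.2, rfl⟩)
  exact ⟨⟨π₀, hval.symm⟩, Set.forall_mem_range.2 fun π => hval ▸ hmax' π⟩

theorem isGreatest_valueToGo [Nonempty A₁] [Nonempty A₂] (M : ZsPOSG S A₁ A₂ Z₁ Z₂) (n : ℕ) :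
    ∀ t, ∀ x ∈ stdSimplex ℝ (Omega₁ S A₁ Z₁ t × Hist A₂ Z₂ t),
      IsGreatest (Set.range fun π => Val (Set.range (M.alpha₁ n t π)) x)
        (M.valueToGo n t x) := by
  induction n with
  | zero =>
    intro t x _
    have h : ∀ π, Val (Set.range (M.alpha₁ 0 t π)) x = 0 := fun π => by
      simp [Val, alpha₁, dotProduct]
    simp only [h, Set.range_const]
    exact isGreatest_singleton
  | succ n ih =>
    exact fun t x hx => M.isGreatest_bellman₁ (fun y hy => M.isGreatest_bellman₂ (ih (t + 1)) hy) hx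

end ZsPOSG

end

theorem theorem3 {S A₁ A₂ Z₁ Z₂ : Type*} [Fintype S] [Fintype A₁] [Fintype A₂] [Fintype Z₁]
    [Fintype Z₂] [Nonempty A₁] [Nonempty A₂] (M : ZsPOSG S A₁ A₂ Z₁ Z₂) :
    (∀ t ≤ M.ℓ, ∀ Γ₁ : Set (Set (Omega₁ S A₁ Z₁ t → ℝ)),
      RepresentsNonDominated (Hist A₂ Z₂ t) (M.envelope₁ t) Γ₁ →
        (∀ Γ₂ ∈ Γ₁, Γ₂.Finite ∧ Γ₂.Nonempty) ∧
        ∀ x ∈ stdSimplex ℝ (Omega₁ S A₁ Z₁ t × Hist A₂ Z₂ t),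
          IsGreatest ((fun Γ₂ => Val Γ₂ x) '' Γ₁) (M.vSeq₁ t x)) ∧
    (∀ t < M.ℓ, ∀ Γ₁ : Set (Set (Omega₂ S A₁ Z₁ t → ℝ)),
      RepresentsNonDominated (Hist A₂ Z₂ t) (M.envelope₂ t) Γ₁ →
        (∀ Γ₂ ∈ Γ₁, Γ₂.Finite ∧ Γ₂.Nonempty) ∧
        ∀ x ∈ stdSimplex ℝ (Omega₂ S A₁ Z₁ t × Hist A₂ Z₂ t),
          IsGreatest ((fun Γ₂ => Val Γ₂ x) '' Γ₁) (M.vSeq₂ t x)) := by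
  refine ⟨fun t _ Γ₁ hΓ => ⟨fun _ hΓ₂ => ?_, fun x hx => ?_⟩,
    fun t _ Γ₁ hΓ => ⟨fun _ hΓ₂ => ?_, fun x hx => ?_⟩⟩
  · exact RepresentsNonDominated.finite_nonempty (B := M.alpha₁ (M.ℓ - t) t) hΓ hΓ₂
  · exact RepresentsNonDominated.isGreatest (M.isCompact_range_alpha₁ (M.ℓ - t) t) hΓ hx
      (M.isGreatest_valueToGo (M.ℓ - t) t x hx)
  · exact RepresentsNonDominated.finite_nonempty (B := M.alpha₂ (M.ℓ - (t + 1)) t) hΓ hΓ₂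
  · exact RepresentsNonDominated.isGreatest (M.isCompact_range_alpha₂ (M.ℓ - (t + 1)) t) hΓ hx
      (M.isGreatest_bellman₂ (M.isGreatest_valueToGo (M.ℓ - (t + 1)) (t + 1)) hx)
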